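/- All spaces are Hausdorff. A space is scattered if it has no nonempty closed subset without isolated points. For a continuous map $\pi:X\to Y$ between compact spaces, a loose family for $\pi$ is a pairwise disjoint family $\mathcal P$ of closed subsets of $X$ such that, for some non-scattered $Q\subseteq Y$, $\pi(P)=Q$ for all $P\in\mathcal P$. A compact space $X$ is $2$-superdissipated if there are a compact metrizable space $Y$ and a continuous map $\pi:X\to Y$ such that $\pi$ has no loose family of size $2$ and every fibre $\pi^{-1}\{y\}$, $y\in Y$, is scattered. Theorem. Let $X$ be a compact Hausdorff space that is $2$-superdissipated and not second countable. Then $X$ has the NTIP; that is, every subalgebra $\mathcal A$ of $C(X)=C(X,\mathbb C)$ that contains the constant functions, separates the points of $X$ and is closed in the supremum norm contains an idempotent $f=f^2$ with $f\neq 0$ and $f\neq 1$. -/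

import Mathlib

universe u v

/-- A space is scattered iff it has no perfect subset, where perfect sets are required to be
nonempty (Mathlib's `Perfect` is "closed and without isolated points"). -/
def IsScatteredSpace (X : Type u) [TopologicalSpace X] : Prop :=
  ¬ ∃ P : Set X, P.Nonempty ∧ Perfect P

/-- A loose family for `f : X → Y`: a disjoint family of closed subsets of `X` which all have the
same image `Q`, for some `Q ⊆ Y` that is not scattered (in its subspace topology). -/
def IsLooseFamily {X : Type u} {Y : Type v} [TopologicalSpace X] [TopologicalSpace Y]
    (f : C(X, Y)) (F : Set (Set X)) : Prop :=
  (∀ P ∈ F, IsClosed P) ∧ F.Pairwise Disjoint ∧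
    ∃ Q : Set Y, ¬ IsScatteredSpace Q ∧ ∀ P ∈ F, f '' P = Q

/-- `f` is `κ`-tight iff it has no loose family of size `κ`. -/
def IsTightMap {X : Type u} {Y : Type v} [TopologicalSpace X] [TopologicalSpace Y]
    (κ : Cardinal.{u}) (f : C(X, Y)) : Prop :=
  ¬ ∃ F : Set (Set X), IsLooseFamily f F ∧ Cardinal.mk F = κ

/-- `f` is `κ`-supertight iff it is `κ`-tight and all its fibres are scattered. -/
def IsSupertightMap {X : Type u} {Y : Type v} [TopologicalSpace X] [TopologicalSpace Y]
    (κ : Cardinal.{u}) (f : C(X, Y)) : Prop :=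
  IsTightMap κ f ∧ ∀ y : Y, IsScatteredSpace (f ⁻¹' {y})

/-- A compact Hausdorff space `X` is `κ`-superdissipated iff it has a `κ`-supertight map to some
compact metrizable space `Y` (in an arbitrary universe; `f` need not be onto). -/
def IsSuperdissipated (κ : Cardinal.{u}) (X : Type u) [TopologicalSpace X] [CompactSpace X]
    [T2Space X] : Prop :=
  ∃ (Y : Type v) (_ : TopologicalSpace Y) (_ : CompactSpace Y)
    (_ : TopologicalSpace.MetrizableSpace Y) (f : C(X, Y)), IsSupertightMap κ f

/-- The NTIP: every subalgebra of `C(X, ℂ)` which contains the constants (automatic for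
`Subalgebra ℂ`), separates points and is closed in the supremum norm contains an idempotent
different from `0` and `1`. -/
def HasNTIP (X : Type u) [TopologicalSpace X] [CompactSpace X] [T2Space X] : Prop :=
  ∀ A : Subalgebra ℂ C(X, ℂ), A.SeparatesPoints → IsClosed (A : Set C(X, ℂ)) →
    ∃ f ∈ A, IsIdempotentElem f ∧ f ≠ 0 ∧ f ≠ 1

/-!
Let `f : X → Y` be `2`-supertight with `Y` compact metric, and let `A` be a closed subalgebra of
`C(X, ℂ)` that separates points and has no nontrivial idempotent. The proof shows that countably
many real parts of elements of `A` separate the points of `X`, so that `X` is second countable.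

The lack of idempotents is used in the following form. If `c ∈ A` and `re c` omits the value `r`,
then `re c` lies entirely on one side of `r`. Otherwise, with `r = 0`, the powers of the Cayley
transform of `c` separate the two sides: `(1 + c) ^ n / ((1 + c) ^ n + (1 - c) ^ n)` converges
uniformly to the indicator function of the clopen set where `re c > 0`
(`Subalgebra.exists_idempotent_of_re_ne`). These quotients lie in `A` because the zeros of the
denominator, as a polynomial in `c`, are on the imaginary axis, which does not meet the spectrum of
`c` relative to `A` (`Subalgebra.notMem_spectrum_of_re_eq_zero`).

Supertightness is used in the following form. For a continuous `u : X → ℝ`, only countably many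
fibres of `f` carry more than one value of `u`, because `f` has no loose family of size two, and
each of them carries only countably many values, because it is scattered. So the differences
`u x - u x'` with `f x = f x'` form a countable set
(`IsSupertightMap.countable_fibre_differences`), and some `r` strictly between `0` and `1` is not
the absolute value of such a difference. If `u = re a`, `v = re b` with `a, b ∈ A`, and if the
compact sets `{(f x, u x)}` and `{(f x, v x)}` are sufficiently close in the Hausdorff metric, then
`|u - v|` omits the value `r` as well (`exists_pos_forall_dist_graphOver_lt`). If moreover
`a` and `b` vanish at a common point, the first part gives `|u - v| < r < 1` everywhere.

The hyperspace of `Y × ℝ` is second countable, so by the Lindelöf property countably many `a`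
suffice to approximate the real parts of all elements of `A` vanishing at the base point with error
less than `1`. As elements of `A` can be rescaled, these countably many real parts separate points.
-/

open Set Filter Topology TopologicalSpace

/-! ### Countability of fibre differences -/

/-- If the range were uncountable, it would contain a nonempty perfect set `C`. A minimal closed set
that is mapped onto `C` has no isolated points, because an isolated point of it would be mapped to
an isolated point of `C`. -/
theorem IsScatteredSpace.countable_range {E Z : Type u} [TopologicalSpace E] [CompactSpace E]
    [T2Space E] [TopologicalSpace Z] [T2Space Z] [SecondCountableTopology Z]
    (hE : IsScatteredSpace E) {g : E → Z} (hg : Continuous g) : (range g).Countable := by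
  by_contra hunc
  obtain ⟨C, hC, hCne, hCsub⟩ := exists_perfect_nonempty_of_isClosed_of_not_countable
    (isCompact_range hg).isClosed hunc
  have hD : IsClosed (g ⁻¹' C) := hC.closed.preimage hg
  have : CompactSpace (g ⁻¹' C) := isCompact_iff_compactSpace.1 hD.isCompact
  have hsurj : (C.restrictPreimage g).Surjective := by
    rintro ⟨c, hc⟩
    obtain ⟨e, rfl⟩ := hCsub hc
    exact ⟨⟨e, hc⟩, rfl⟩
  obtain ⟨M, hMc, hMsurj, hMmin⟩ :=
    exists_compact_surjective_zorn_subset hg.restrictPreimage hsurj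
  have hMcl : IsClosed M := (isCompact_iff_compactSpace.2 hMc).isClosed
  have hPcl : IsClosed (Subtype.val '' M : Set E) :=
      hD.isClosedEmbedding_subtypeVal.isClosedMap M hMcl
  refine hE ⟨Subtype.val '' M, ?_, hPcl, ?_⟩
  · obtain ⟨c, hc⟩ := hCne
    obtain ⟨m, hm, -⟩ := hMsurj.symm ▸ mem_univ (⟨c, hc⟩ : C)
    exact ⟨m, m, hm, rfl⟩
  rintro _ ⟨m, hm, rfl⟩
  by_contra hacc
  simp only [accPt_iff_nhds, not_forall, not_exists, not_and, not_not] at hacc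
  obtain ⟨U, hU, hUm⟩ := hacc
  obtain ⟨V, hVU, hV, hmV⟩ := mem_nhds_iff.1 hU
  -- Off the isolated point `m`, the minimal set `M` is still closed.
  let M' : Set M := {e | (e : g ⁻¹' C).1 ∉ V}
  have hM' : IsClosed M' :=
    hV.isClosed_compl.preimage (continuous_subtype_val.comp continuous_subtype_val)
  have hM'ne : M' ≠ univ := fun h => (h.symm ▸ mem_univ (⟨m, hm⟩ : M) : _ ∈ M') hmV
  obtain ⟨c, hc⟩ := (ne_univ_iff_exists_notMem _).1 (hMmin M' hM'ne hM')
  have hM'c : IsCompact (g ∘ Subtype.val ∘ Subtype.val '' M') :=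
    hM'.isCompact.image (hg.comp (continuous_subtype_val.comp continuous_subtype_val))
  have hcU : ((g ∘ Subtype.val ∘ Subtype.val '' M')ᶜ : Set Z) ∈ 𝓝 (c : Z) := by
    refine hM'c.isClosed.isOpen_compl.mem_nhds ?_
    rintro ⟨e, he, hec⟩
    exact hc ⟨e, he, Subtype.ext hec⟩
  -- Only `m` can be sent to the missed point, so that point would be isolated in `C`.
  have key : ∀ e : M, (e : g ⁻¹' C).1 ∉ V ∨ (e : g ⁻¹' C) = m := fun e =>
    or_iff_not_imp_left.2 fun he =>
      Subtype.ext (hUm _ ⟨hVU (not_not.1 he), e, e.2, rfl⟩)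
  obtain ⟨d, ⟨hdU, hdC⟩, hdc⟩ := accPt_iff_nhds.1 (hC.acc c c.2) _ hcU
  have hit : ∀ z : C, (z : Z) ∉ (g ∘ Subtype.val ∘ Subtype.val '' M' : Set Z) → g m = z := by
    intro z hz
    obtain ⟨e, he, hez⟩ := hMsurj.symm ▸ mem_univ z
    have hgez : g e = z := congrArg Subtype.val hez
    rcases key ⟨e, he⟩ with h | h
    · exact absurd ⟨⟨e, he⟩, h, hgez⟩ hz
    · rw [← hgez, ← (show e = m from h)]
  exact hdc ((hit ⟨d, hdC⟩ hdU).symm.trans (hit c (mem_of_mem_nhds hcU)))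

section
variable {X : Type u} {Y : Type v} [TopologicalSpace X] [CompactSpace X]
  [TopologicalSpace Y] [T2Space Y] [SecondCountableTopology Y]

/-- If the common image of two disjoint closed sets were uncountable, the parts of the two sets that
lie over it would form a loose family of size two. -/
theorem IsTightMap.countable_image_inter_image {f : C(X, Y)} (hf : IsTightMap 2 f) {P P' : Set X}
    (hP : IsClosed P) (hP' : IsClosed P') (hPP' : Disjoint P P') :
    (f '' P ∩ f '' P').Countable := by
  by_contra hunc
  set Q : Set Y := f '' P ∩ f '' P' with hQ
  have hQcl : IsClosed Q :=
    (hP.isCompact.image f.continuous).isClosed.inter (hP'.isCompact.image f.continuous).isClosed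
  have himage : ∀ R : Set X, Q ⊆ f '' R → f '' (R ∩ f ⁻¹' Q) = Q := fun R hR => by
    rw [image_inter_preimage, inter_eq_right.2 hR]
  have hd : Disjoint (P ∩ f ⁻¹' Q) (P' ∩ f ⁻¹' Q) :=
    hPP'.mono inter_subset_left inter_subset_left
  obtain ⟨y, hy⟩ : Q.Nonempty := by
    by_contra h
    exact hunc (not_nonempty_iff_eq_empty.1 h ▸ countable_empty)
  have hne : P ∩ f ⁻¹' Q ≠ P' ∩ f ⁻¹' Q := by
    intro h
    obtain ⟨x, hx, hxy⟩ := hy.1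
    have hxQ : x ∈ P ∩ f ⁻¹' Q := ⟨hx, by rw [mem_preimage, hxy]; exact hy⟩
    exact disjoint_left.1 hd hxQ (h ▸ hxQ)
  refine hf ⟨{P ∩ f ⁻¹' Q, P' ∩ f ⁻¹' Q}, ⟨?_, ?_, Q, ?_, ?_⟩, ?_⟩
  · rintro _ (rfl | rfl)
    exacts [hP.inter (hQcl.preimage f.continuous), hP'.inter (hQcl.preimage f.continuous)]
  · exact pairwise_pair_of_symm.2 fun _ => hd
  · have huniv : ¬ (univ : Set Q).Countable := fun h =>
      hunc (countable_coe_iff.1 (countable_univ_iff.1 h))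
    obtain ⟨D, hD, hDne, -⟩ :=
      exists_perfect_nonempty_of_isClosed_of_not_countable isClosed_univ huniv
    exact fun h => h ⟨D, hDne, hD⟩
  · rintro _ (rfl | rfl)
    exacts [himage P inter_subset_left, himage P' inter_subset_right]
  · rw [Cardinal.mk_insert (by simpa using hne), Cardinal.mk_singleton]
    norm_num

/-- Only countably many fibres of a `2`-tight map fail to be level sets of a given continuous
real-valued function. -/
theorem IsTightMap.countable_nonconstant {f : C(X, Y)} (hf : IsTightMap 2 f) {u : X → ℝ}
    (hu : Continuous u) : {y | ∃ x x', f x = y ∧ f x' = y ∧ u x < u x'}.Countable := by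
  refine (countable_iUnion fun p : ℚ => countable_iUnion fun q : ℚ => countable_iUnion
    fun h : p < q => hf.countable_image_inter_image (isClosed_le hu continuous_const)
      (isClosed_le continuous_const hu) (disjoint_left.2 fun x
        (hx : u x ≤ p) (hx' : q ≤ u x) => ?_)).mono ?_
  · exact absurd (hx'.trans hx) (not_le.2 (Rat.cast_lt.2 h))
  · rintro y ⟨x, x', hx, hx', hlt⟩
    obtain ⟨p, hp, hpx⟩ := exists_rat_btwn hlt
    obtain ⟨q, hq, hqx⟩ := exists_rat_btwn hpx
    simp only [mem_iUnion]
    exact ⟨p, q, Rat.cast_lt.1 hq, ⟨x, hp.le, hx⟩, ⟨x', hqx.le, hx'⟩⟩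

theorem IsSupertightMap.countable_fibre_differences [T2Space X] {f : C(X, Y)}
    (hf : IsSupertightMap 2 f) {u : X → ℝ} (hu : Continuous u) :
    {t | ∃ x x', f x = f x' ∧ u x - u x' = t}.Countable := by
  have himage : ∀ y, (u '' (f ⁻¹' {y})).Countable := fun y => by
    have : CompactSpace (f ⁻¹' {y}) :=
      isCompact_iff_compactSpace.1 (isClosed_singleton.preimage f.continuous).isCompact
    -- The lift to `ULift` places `ℝ` in the universe of `X`.
    have := ((hf.2 y).countable_range (Z := ULift.{u} ℝ)
      (continuous_uliftUp.comp (hu.comp continuous_subtype_val))).image ULift.down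
    rwa [← range_comp, ← Function.comp_assoc, show ULift.down ∘ ULift.up = (id : ℝ → ℝ) from rfl,
      Function.id_comp, range_comp, Subtype.range_coe] at this
  refine ((countable_singleton 0).union ((hf.1.countable_nonconstant hu).biUnion
    fun y _ => (himage y).image2 (himage y) (· - ·))).mono ?_
  rintro _ ⟨x, x', h, rfl⟩
  rcases lt_trichotomy (u x) (u x') with hlt | heq | hlt
  · exact Or.inr (mem_biUnion (show f x ∈ _ from ⟨x, x', rfl, h.symm, hlt⟩)
      ⟨_, ⟨x, rfl, rfl⟩, _, ⟨x', h.symm, rfl⟩, rfl⟩)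
  · exact Or.inl (sub_eq_zero.2 heq)
  · exact Or.inr (mem_biUnion (show f x ∈ _ from ⟨x', x, h.symm, rfl, hlt⟩)
      ⟨_, ⟨x, rfl, rfl⟩, _, ⟨x', h.symm, rfl⟩, rfl⟩)
end

/-! ### Idempotents in closed subalgebras of `C(X, ℂ)` -/

theorem norm_pow_div_le_of_norm_le {a b : ℂ} {q : ℝ} (hq0 : 0 ≤ q) (hq : q < 1) (hb : b ≠ 0)
    (hab : ‖a‖ ≤ q * ‖b‖) {n : ℕ} (hn : n ≠ 0) :
    ‖a ^ n / (b ^ n + a ^ n)‖ ≤ q ^ n / (1 - q ^ n) := by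
  have hqn : q ^ n < 1 := pow_lt_one₀ hq0 hq hn
  have hbn : 0 < ‖b‖ ^ n := pow_pos (norm_pos_iff.2 hb) n
  have ha : ‖a ^ n‖ ≤ q ^ n * ‖b‖ ^ n := by
    rw [norm_pow, ← mul_pow]
    exact pow_le_pow_left₀ (norm_nonneg _) hab n
  have hden : (1 - q ^ n) * ‖b‖ ^ n ≤ ‖b ^ n + a ^ n‖ := by
    have := norm_sub_le_norm_add (b ^ n) (a ^ n)
    rw [norm_pow b] at this
    linarith
  have h1 : 0 < 1 - q ^ n := sub_pos.2 hqn
  rw [norm_div]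
  calc ‖a ^ n‖ / ‖b ^ n + a ^ n‖ ≤ (q ^ n * ‖b‖ ^ n) / ((1 - q ^ n) * ‖b‖ ^ n) := by
        gcongr
    _ = q ^ n / (1 - q ^ n) := by field_simp

theorem norm_one_add_eq_norm_one_sub_iff {z : ℂ} : ‖1 + z‖ = ‖1 - z‖ ↔ z.re = 0 := by
  rw [← sq_eq_sq₀ (norm_nonneg _) (norm_nonneg _), Complex.sq_norm, Complex.sq_norm]
  simp only [Complex.normSq_apply, Complex.add_re, Complex.sub_re, Complex.add_im, Complex.sub_im,
    Complex.one_re, Complex.one_im]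
  constructor <;> intro h <;> nlinarith

theorem norm_one_sub_lt_norm_one_add_iff {z : ℂ} : ‖1 - z‖ < ‖1 + z‖ ↔ 0 < z.re := by
  rw [← sq_lt_sq₀ (norm_nonneg _) (norm_nonneg _), Complex.sq_norm, Complex.sq_norm]
  simp only [Complex.normSq_apply, Complex.add_re, Complex.sub_re, Complex.add_im, Complex.sub_im,
    Complex.one_re, Complex.one_im]
  constructor <;> intro h <;> nlinarith

section
variable {X : Type*} [TopologicalSpace X] [CompactSpace X]

/-- If the range of `c` misses the imaginary axis, then so does the spectrum of `c` relative to the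
closed subalgebra `A`: the axis is connected and unbounded, so it lies in the unbounded component
of the complement of the range, and passing to `A` only fills in bounded components. -/
theorem Subalgebra.notMem_spectrum_of_re_eq_zero {A : Subalgebra ℂ C(X, ℂ)}
    (hA : IsClosed (A : Set C(X, ℂ))) (c : A) (hc : ∀ x, ((c : C(X, ℂ)) x).re ≠ 0) {z : ℂ}
    (hz : z.re = 0) : z ∉ spectrum ℂ c := by
  intro hmem
  have := hA
  have hb := Subalgebra.spectrum_isBounded_connectedComponentIn A c hmem
  -- `L` is the imaginary axis.
  let L : Set ℂ := {w | w.re = 0}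
  have hLc : IsPreconnected L := by
    have : Convex ℝ L := convex_hyperplane Complex.reLm.isLinear 0
    exact this.isPreconnected
  have hLs : L ⊆ (spectrum ℂ (c : C(X, ℂ)))ᶜ := by
    intro w hw hws
    rw [ContinuousMap.spectrum_eq_range] at hws
    obtain ⟨x, rfl⟩ := hws
    exact hc x hw
  have hsub := hb.subset (hLc.subset_connectedComponentIn (show z ∈ L from hz) hLs)
  obtain ⟨R, hR⟩ := hsub.exists_norm_le
  have := hR ((|R| + 1 : ℝ) * Complex.I) (by simp [L])
  rw [norm_mul, Complex.norm_I, mul_one, Complex.norm_real, Real.norm_eq_abs] at this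
  have h1 := le_abs_self (|R| + 1)
  have h2 := le_abs_self R
  linarith

open Polynomial in
/-- By the spectral mapping theorem the denominator is a unit of `A`: a zero `z` of the polynomial
`(1 + z) ^ n + (1 - z) ^ n` satisfies `‖1 + z‖ = ‖1 - z‖`, so it lies on the imaginary axis. -/
theorem Subalgebra.exists_mem_eq_pow_div [Nonempty X] {A : Subalgebra ℂ C(X, ℂ)}
    (hA : IsClosed (A : Set C(X, ℂ))) (c : A) (hc : ∀ x, ((c : C(X, ℂ)) x).re ≠ 0) (n : ℕ) :
    ∃ w ∈ A, ∀ x, w x = (1 + (c : C(X, ℂ)) x) ^ n /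
      ((1 + (c : C(X, ℂ)) x) ^ n + (1 - (c : C(X, ℂ)) x) ^ n) := by
  have : CompleteSpace A := hA.completeSpace_coe
  let p : ℂ[X] := (1 + Polynomial.X) ^ n + (1 - Polynomial.X) ^ n
  have hp : IsUnit (aeval c p) := by
    by_contra h
    have h0 : (0 : ℂ) ∈ spectrum ℂ (aeval c p) := spectrum.zero_mem_iff ℂ |>.2 h
    rw [spectrum.map_polynomial_aeval] at h0
    obtain ⟨z, hz, hz0⟩ := h0
    refine Subalgebra.notMem_spectrum_of_re_eq_zero hA c hc ?_ hz
    rw [← norm_one_add_eq_norm_one_sub_iff]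
    have hz1 : (1 + z) ^ n = -(1 - z) ^ n := by
      simpa [p, add_eq_zero_iff_eq_neg] using hz0
    rcases eq_or_ne n 0 with rfl | hn
    · norm_num at hz1
    have := congrArg norm hz1
    rw [norm_neg, norm_pow, norm_pow] at this
    exact (pow_left_inj₀ (norm_nonneg _) (norm_nonneg _) hn).1 this
  obtain ⟨v, hv⟩ := hp.exists_right_inv
  refine ⟨((1 + c) ^ n * v : A), Subtype.property _, fun x => ?_⟩
  have hvx : ((1 + (c : C(X, ℂ)) x) ^ n + (1 - (c : C(X, ℂ)) x) ^ n) * (v : C(X, ℂ)) x = 1 := by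
    have := congrArg (fun a : A => (a : C(X, ℂ)) x) hv
    simpa [p] using this
  rw [eq_div_iff (left_ne_zero_of_mul_eq_one hvx)]
  have : (((1 + c) ^ n * v : A) : C(X, ℂ)) x
      = (1 + (c : C(X, ℂ)) x) ^ n * (v : C(X, ℂ)) x := by simp
  rw [this, mul_assoc, mul_comm ((v : C(X, ℂ)) x), hvx, mul_one]

/-- The indicator function of `{x | 0 < (c x).re}` is the uniform limit of the functions
`(1 + c) ^ n / ((1 + c) ^ n + (1 - c) ^ n)`, all of which lie in `A`. -/
theorem Subalgebra.exists_idempotent_of_re_ne [Nonempty X] {A : Subalgebra ℂ C(X, ℂ)}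
    (hA : IsClosed (A : Set C(X, ℂ))) {c : C(X, ℂ)} (hcA : c ∈ A) (hc : ∀ x, (c x).re ≠ 0)
    {x₀ x₁ : X} (h₀ : (c x₀).re < 0) (h₁ : 0 < (c x₁).re) :
    ∃ f ∈ A, IsIdempotentElem f ∧ f ≠ 0 ∧ f ≠ 1 := by
  have hre : Continuous fun x => (c x).re := Complex.continuous_re.comp c.continuous
  have hclopen : IsClopen {x | 0 < (c x).re} := by
    refine ⟨?_, isOpen_lt continuous_const hre⟩
    have : {x | 0 < (c x).re} = {x | 0 ≤ (c x).re} :=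
      Set.ext fun x => ((hc x).symm.le_iff_lt).symm
    rw [this]
    exact isClosed_le continuous_const hre
  let e : C(X, ℂ) := ⟨indicator {x | 0 < (c x).re} 1, continuous_one.indicator fun x hx => by
    simp [hclopen.frontier_eq] at hx⟩
  have he₁ : ∀ x, 0 < (c x).re → e x = 1 := fun x hx =>
    indicator_of_mem (s := {x | 0 < (c x).re}) hx 1
  have he₀ : ∀ x, (c x).re < 0 → e x = 0 := fun x hx =>
    indicator_of_notMem (s := {x | 0 < (c x).re}) (not_lt.2 hx.le) 1
  refine ⟨e, ?_, ?_, ?_, ?_⟩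
  · choose w hwA hw using Subalgebra.exists_mem_eq_pow_div hA ⟨c, hcA⟩ hc
    simp only at hw
    -- `q < 1` bounds the ratio of the smaller of `‖1 + c x‖`, `‖1 - c x‖` to the larger one.
    have hlt : ∀ x, min ‖1 + c x‖ ‖1 - c x‖ < max ‖1 + c x‖ ‖1 - c x‖ := fun x =>
      min_lt_max.2 fun h => hc x (norm_one_add_eq_norm_one_sub_iff.1 h)
    have hpos : ∀ x, 0 < max ‖1 + c x‖ ‖1 - c x‖ := fun x =>
      (le_min (norm_nonneg _) (norm_nonneg _)).trans_lt (hlt x)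
    have hcont : Continuous fun x => min ‖1 + c x‖ ‖1 - c x‖ / max ‖1 + c x‖ ‖1 - c x‖ :=
      Continuous.div (by fun_prop) (by fun_prop) fun x => (hpos x).ne'
    obtain ⟨y, -, hy⟩ := isCompact_univ.exists_isMaxOn univ_nonempty hcont.continuousOn
    set q := min ‖1 + c y‖ ‖1 - c y‖ / max ‖1 + c y‖ ‖1 - c y‖
    have hq0 : 0 ≤ q := div_nonneg (le_min (norm_nonneg _) (norm_nonneg _)) (hpos y).le
    have hq1 : q < 1 := (div_lt_one (hpos y)).2 (hlt y)
    have hq : ∀ x, min ‖1 + c x‖ ‖1 - c x‖ ≤ q * max ‖1 + c x‖ ‖1 - c x‖ := fun x =>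
      (div_le_iff₀ (hpos x)).1 (hy (mem_univ x))
    have hqn : Tendsto (fun n : ℕ => q ^ n) atTop (𝓝 0) :=
      tendsto_pow_atTop_nhds_zero_of_lt_one hq0 hq1
    have hbound : ∀ n ≠ 0, ‖w n - e‖ ≤ q ^ n / (1 - q ^ n) := by
      intro n hn
      refine (ContinuousMap.norm_le _
        (div_nonneg (by positivity) (sub_nonneg.2 (pow_le_one₀ hq0 hq1.le)))).2 fun x => ?_
      have hqx := hq x
      rw [ContinuousMap.sub_apply, hw]
      rcases (hc x).lt_or_gt with h | h
      · have hlt' : ‖1 + c x‖ < ‖1 - c x‖ := by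
          have := norm_one_sub_lt_norm_one_add_iff (z := -c x)
          simp only [sub_neg_eq_add, ← sub_eq_add_neg, Complex.neg_re] at this
          exact this.2 (by linarith)
        rw [min_eq_left hlt'.le, max_eq_right hlt'.le] at hqx
        rw [he₀ x h, sub_zero, add_comm (_ ^ n)]
        exact norm_pow_div_le_of_norm_le hq0 hq1
          (norm_pos_iff.1 ((norm_nonneg _).trans_lt hlt')) hqx hn
      · have hlt' := norm_one_sub_lt_norm_one_add_iff.2 h
        rw [min_eq_right hlt'.le, max_eq_left hlt'.le] at hqx
        have hden : (1 + c x) ^ n + (1 - c x) ^ n ≠ 0 := by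
          intro h0
          have := congrArg norm (eq_neg_of_add_eq_zero_left h0)
          rw [norm_neg, norm_pow, norm_pow] at this
          exact hlt'.ne ((pow_left_inj₀ (norm_nonneg _) (norm_nonneg _) hn).1 this).symm
        rw [he₁ x h, ← norm_neg]
        have : -((1 + c x) ^ n / ((1 + c x) ^ n + (1 - c x) ^ n) - 1)
            = (1 - c x) ^ n / ((1 + c x) ^ n + (1 - c x) ^ n) := by
          field_simp
          ring
        rw [this]
        exact norm_pow_div_le_of_norm_le hq0 hq1
          (norm_pos_iff.1 ((norm_nonneg _).trans_lt hlt')) hqx hn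
    have hlim : Tendsto (fun n : ℕ => q ^ n / (1 - q ^ n)) atTop (𝓝 0) := by
      have := hqn.div (tendsto_const_nhds.sub hqn) (by simp : (1 : ℝ) - 0 ≠ 0)
      rwa [zero_div] at this
    refine hA.mem_of_tendsto (tendsto_iff_norm_sub_tendsto_zero.2
      (squeeze_zero' (Eventually.of_forall fun _ => norm_nonneg _) ?_ hlim))
      (Eventually.of_forall hwA)
    filter_upwards [eventually_ne_atTop 0] with n hn using hbound n hn
  · ext x
    rcases (hc x).lt_or_gt with h | h
    · simp [he₀ x h]
    · simp [he₁ x h]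
  · intro h
    simpa [he₁ x₁ h₁] using congrArg (fun g : C(X, ℂ) => g x₁) h
  · intro h
    simpa [he₀ x₀ h₀] using congrArg (fun g : C(X, ℂ) => g x₀) h

/-- In a closed algebra without nontrivial idempotents real parts have connected ranges, in the
sense that is used here: `|re (a - b)|` cannot jump over a value that it omits. -/
theorem Subalgebra.abs_re_sub_re_lt_of_forall_ne {A : Subalgebra ℂ C(X, ℂ)}
    (hA : IsClosed (A : Set C(X, ℂ))) (hno : ¬ ∃ f ∈ A, IsIdempotentElem f ∧ f ≠ 0 ∧ f ≠ 1)
    {a b : C(X, ℂ)} (ha : a ∈ A) (hb : b ∈ A) {x₀ : X} (hx₀ : a x₀ = b x₀) {r : ℝ} (hr : 0 < r)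
    (hab : ∀ x, |(a x).re - (b x).re| ≠ r) (x : X) : |(a x).re - (b x).re| < r := by
  have : Nonempty X := ⟨x₀⟩
  have hle : ∀ a ∈ A, ∀ b ∈ A, a x₀ = b x₀ → (∀ x, |(a x).re - (b x).re| ≠ r) →
      (a x).re - (b x).re < r := by
    intro a ha b hb hx₀ hab
    by_contra! h
    refine hno (Subalgebra.exists_idempotent_of_re_ne hA (c := a - b - algebraMap ℂ C(X, ℂ) r)
      (A.sub_mem (A.sub_mem ha hb) (A.algebraMap_mem _)) (fun z hz => hab z ?_)
      (x₀ := x₀) (x₁ := x) ?_ ?_)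
    · have : (a z).re - (b z).re = r := by simpa [sub_eq_zero] using hz
      rw [this, abs_of_pos hr]
    · simpa [hx₀] using hr
    · have h' := lt_of_le_of_ne h fun h0 => hab x (by rw [← h0, abs_of_pos hr])
      simpa using h'
  exact abs_sub_lt_iff.2 ⟨hle a ha b hb hx₀ hab,
    hle b hb a ha hx₀.symm fun z => abs_sub_comm (a z).re _ ▸ hab z⟩

end

/-! ### Comparison of real parts by graphs over `Y` -/

section
variable {X : Type u} {Y : Type v} [TopologicalSpace X] [CompactSpace X]

/-- The image of the map `x ↦ (f x, u x)`, that is, the graph of `u` seen as a multivalued function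
on `Y`, as a point of the hyperspace of nonempty compact sets with the Hausdorff metric. -/
def graphOver [Nonempty X] [TopologicalSpace Y] (f : C(X, Y)) (u : C(X, ℝ)) :
    NonemptyCompacts (Y × ℝ) where
  carrier := range fun x => (f x, u x)
  isCompact' := isCompact_range (f.continuous.prodMk u.continuous)
  nonempty' := range_nonempty _

variable [MetricSpace Y]

/-- If `u` never differs by exactly `r` between two points of a fibre of `f`, then `u` differs by
exactly `r` at no point from any `v` whose graph over `f` is close to that of `u`: the value `v x`
is almost a value of `u` at a point whose image under `f` is close to `f x`. -/
theorem exists_pos_forall_dist_graphOver_lt [Nonempty X] (f : C(X, Y)) (u : C(X, ℝ)) {r : ℝ}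
    (hr : ∀ x x', f x = f x' → |u x - u x'| ≠ r) :
    ∃ δ > 0, ∀ v : C(X, ℝ), dist (graphOver f u) (graphOver f v) < δ → ∀ x, |u x - v x| ≠ r := by
  -- `φ` is continuous and positive, so that its minimum `φ p` can serve as `δ`.
  let φ : X × X → ℝ := fun p => max (dist (f p.1) (f p.2)) |(|u p.1 - u p.2| - r)|
  have hφ : Continuous φ := by fun_prop
  obtain ⟨p, -, hp⟩ := isCompact_univ.exists_isMinOn univ_nonempty hφ.continuousOn
  refine ⟨φ p, ?_, fun v hv x hx => ?_⟩
  · rcases eq_or_ne (f p.1) (f p.2) with h | h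
    · exact lt_max_of_lt_right (abs_pos.2 (sub_ne_zero.2 (hr _ _ h)))
    · exact lt_max_of_lt_left (dist_pos.2 h)
  obtain ⟨_, ⟨x', rfl⟩, hx'⟩ := Metric.exists_dist_lt_of_hausdorffDist_lt'
    (show (f x, v x) ∈ (graphOver f v : Set (Y × ℝ)) from ⟨x, rfl⟩) hv
    (edist_ne_top (graphOver f u) (graphOver f v))
  obtain ⟨hd, hdu⟩ := max_lt_iff.1 (Prod.dist_eq (α := Y) (β := ℝ) ▸ hx')
  refine (hp (mem_univ (x, x'))).not_gt (max_lt (dist_comm (f x) _ ▸ hd) ?_)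
  rw [Real.dist_eq] at hdu
  -- `|u x - u x'|` differs from `|u x - v x| = r` by at most `|u x' - v x|`.
  rw [← hx]
  refine (abs_abs_sub_abs_le_abs_sub _ _).trans_lt ?_
  rw [show u x - u x' - (u x - v x) = -(u x' - v x) by ring, abs_neg]
  exact hdu

end

theorem mainTheorem8 (X : Type u) [TopologicalSpace X] [CompactSpace X] [T2Space X]
    (hX : IsSuperdissipated.{u, v} 2 X) (hsc : ¬ SecondCountableTopology X) :
    HasNTIP X := by
  intro A hsep hA
  by_contra hno
  obtain ⟨Y, _, _, _, f, hf⟩ := hX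
  let _ : MetricSpace Y := metrizableSpaceMetric Y
  have hne : Nonempty X := by
    by_contra h
    rw [not_nonempty_iff] at h
    exact hsc inferInstance
  let x₀ : X := Classical.arbitrary X
  -- Vanishing at a common point `x₀` makes `0` a value of each difference `a - b`.
  let A₀ : Type u := {a : C(X, ℂ) // a ∈ A ∧ a x₀ = 0}
  let u : A₀ → C(X, ℝ) := fun a => ⟨fun x => (a.1 x).re, Complex.continuous_re.comp a.1.continuous⟩
  have hball : ∀ a : A₀, ∃ δ > 0, ∀ b : A₀, dist (graphOver f (u a)) (graphOver f (u b)) < δ →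
      ∀ x, |u a x - u b x| < 1 := by
    intro a
    -- Only countably many values of `r` are excluded, whereas the interval is uncountable.
    obtain ⟨r, ⟨hr0, hr1⟩, hr⟩ :
        (Ioo (0 : ℝ) 1 \ {t | ∃ x x', f x = f x' ∧ u a x - u a x' = t}).Nonempty := by
      by_contra h
      rw [not_nonempty_iff_eq_empty, sdiff_eq_empty] at h
      have hc := (hf.countable_fibre_differences (u a).continuous).mono h
      exact (Cardinal.Real.Ioo_countable_iff.1 hc).not_gt one_pos
    have hfib : ∀ x x', f x = f x' → |u a x - u a x'| ≠ r := by
      intro x x' hxx' habs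
      rcases (abs_eq hr0.le).1 habs with h | h
      · exact hr ⟨x, x', hxx', h⟩
      · exact hr ⟨x', x, hxx'.symm, by linarith⟩
    obtain ⟨δ, hδ, h⟩ := exists_pos_forall_dist_graphOver_lt f (u a) hfib
    exact ⟨δ, hδ, fun b hb x => (Subalgebra.abs_re_sub_re_lt_of_forall_ne hA hno a.2.1 b.2.1
      (a.2.2.trans b.2.2.symm) hr0 (h (u b) hb) x).trans hr1⟩
  choose δ hδ hball using hball
  -- The hyperspace of `Y × ℝ` is second countable, so countably many of the balls suffice.
  obtain ⟨T, hT, hcover⟩ := isOpen_iUnion_countable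
    (fun a : A₀ => Metric.ball (graphOver f (u a)) (δ a)) fun _ => Metric.isOpen_ball
  have hdense : ∀ b : A₀, ∃ a ∈ T, ∀ x, |u a x - u b x| < 1 := by
    intro b
    have hb : graphOver f (u b) ∈ ⋃ a ∈ T, Metric.ball (graphOver f (u a)) (δ a) :=
      hcover ▸ mem_iUnion.2 ⟨b, Metric.mem_ball_self (hδ b)⟩
    simp only [mem_iUnion] at hb
    obtain ⟨a, haT, hab⟩ := hb
    exact ⟨a, haT, hball a b (Metric.mem_ball'.1 hab)⟩
  have := hT.to_subtype
  let Φ : X → T → ℝ := fun x a => u a x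
  have hΦ : Continuous Φ := continuous_pi fun a => (u a).continuous
  have hinj : Function.Injective Φ := by
    intro x x' hxx'
    by_contra hne
    obtain ⟨_, ⟨a, ha, rfl⟩, hax⟩ := hsep hne
    -- Rescale so that the difference of the values at `x` and `x'` is `2`.
    have hd : a x - a x' ≠ 0 := sub_ne_zero.2 hax
    let b : A₀ := ⟨(2 / (a x - a x')) • (a - algebraMap ℂ C(X, ℂ) (a x₀)),
      A.smul_mem (A.sub_mem ha (A.algebraMap_mem _)) _, by simp⟩
    obtain ⟨t, ht, htb⟩ := hdense b
    have htx : u t x = u t x' := congrFun hxx' ⟨t, ht⟩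
    have hb : u b x - u b x' = 2 := by
      have : b.1 x - b.1 x' = 2 := by
        simp only [b, ContinuousMap.smul_apply, ContinuousMap.sub_apply, smul_eq_mul,
          _root_.algebraMap_apply]
        rw [← mul_sub, sub_sub_sub_cancel_right, div_mul_cancel₀ _ hd]
      simpa [u] using congrArg Complex.re this
    have h1 := (abs_lt.1 (htb x))
    have h2 := (abs_lt.1 (htb x'))
    linarith [h1.1, h2.2]
  exact hsc (hΦ.isClosedEmbedding hinj).isEmbedding.secondCountableTopology
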